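/- Let $(R,\mathfrak m)$ be a commutative Noetherian Cohen–Macaulay local ring, and let $M$ and $N$ be finitely generated $R$-modules. For a finitely generated module $L$ write $h^i(L)$ for the length of the local cohomology module $H^i_{\mathfrak m}(L)$, and $\beta_j(M)$ for the rank of the $j$-th free module in the minimal free resolution of $M$. Assume that $M$ is perfect, i.e. $M\neq 0$ has finite projective dimension $\operatorname{pd}(M)$ and $\operatorname{pd}(M)=\operatorname{grade}(M)=\inf\{i:\operatorname{Ext}^i_R(M,R)\ne 0\}$. Assume also that $N$ is locally free of constant rank on the punctured spectrum, i.e. there is an integer $r\ge 0$ such that $N_{\mathfrak p}$ is free of rank $r$ over $R_{\mathfrak p}$ for every prime ideal $\mathfrak p\neq\mathfrak m$. Then for every integer $i$ with $0\le i<\dim M$ the numbers $h^i(M\otimes_R N)$ and $h^{j+i}(N)$, $0\le j\le\operatorname{pd}(M)$, are finite, and $$h^i(M\otimes_R N)\;\le\;\sum_{j=0}^{\operatorname{pd}(M)}\beta_j(M)\,h^{j+i}(N).$$ -/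

import Mathlib

open IsLocalRing CategoryTheory
open scoped TensorProduct

universe u

section Resolutions

variable (R : Type u) [CommRing R] [IsLocalRing R]
variable (M : Type u) [AddCommGroup M] [Module R M]

/-- A minimal free resolution
`⋯ → R ^ rank 1 → R ^ rank 0 → M → 0` of a module over a local ring `(R, 𝔪)`: an exact complex of
free modules of finite rank such that the image of every differential lies in `𝔪 R ^ rank i`. -/
structure MinimalFreeResolution where
  /-- the ranks of the free modules -/
  rank : ℕ → ℕ
  /-- the augmentation -/
  aug : (Fin (rank 0) → R) →ₗ[R] M
  /-- the differentials -/
  d : ∀ i : ℕ, (Fin (rank (i + 1)) → R) →ₗ[R] (Fin (rank i) → R)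
  aug_surjective : Function.Surjective aug
  exact_aug : Function.Exact (d 0) aug
  exact : ∀ i : ℕ, Function.Exact (d (i + 1)) (d i)
  minimal : ∀ i : ℕ, LinearMap.range (d i) ≤
    maximalIdeal R • (⊤ : Submodule R (Fin (rank i) → R))

variable {R} in
theorem mem_smul_top_of_forall_mem {n : ℕ} (x : Fin n → R) (h : ∀ i, x i ∈ maximalIdeal R) :
    x ∈ maximalIdeal R • (⊤ : Submodule R (Fin n → R)) := by
  rw [pi_eq_sum_univ' x]
  exact Submodule.sum_mem _ fun i _ => Submodule.smul_mem_smul (h i) trivial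

/-- Every finitely generated module over a local ring has a minimal free cover. -/
theorem exists_minimal_free_cover [Module.Finite R M] :
    ∃ (n : ℕ) (f : (Fin n → R) →ₗ[R] M), Function.Surjective f ∧
      LinearMap.ker f ≤ maximalIdeal R • (⊤ : Submodule R (Fin n → R)) := by
  classical
  have hex : ∃ n : ℕ, ∃ f : (Fin n → R) →ₗ[R] M, Function.Surjective f :=
    Module.Finite.exists_fin' R M
  obtain ⟨f, hf⟩ := Nat.find_spec hex
  refine ⟨Nat.find hex, f, hf, fun x hx => mem_smul_top_of_forall_mem x fun i => ?_⟩
  have hmin : ∀ m < Nat.find hex, ¬ ∃ g : (Fin m → R) →ₗ[R] M, Function.Surjective g :=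
    fun m hm => Nat.find_min hex hm
  generalize Nat.find hex = n at f hf x hx i hmin
  by_contra hi
  obtain _ | n := n
  · exact i.elim0
  have hu : IsUnit (x i) := by
    simpa [mem_maximalIdeal, mem_nonunits_iff] using hi
  obtain ⟨c, hc⟩ := hu.exists_left_inv
  let g : (Fin n → R) →ₗ[R] (Fin (n + 1) → R) :=
    { toFun := fun w => i.insertNth (α := fun _ => R) 0 w
      map_add' := fun v w => by
        ext j
        refine Fin.succAboveCases i ?_ (fun k => ?_) j <;> simp
      map_smul' := fun r v => by
        ext j
        refine Fin.succAboveCases i ?_ (fun k => ?_) j <;> simp }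
  refine hmin n (Nat.lt_succ_self n) ⟨f ∘ₗ g, fun y => ?_⟩
  obtain ⟨v, rfl⟩ := hf y
  refine ⟨fun j => (v - (v i * c) • x) (i.succAbove j), ?_⟩
  have hg : g (fun j => (v - (v i * c) • x) (i.succAbove j)) = v - (v i * c) • x := by
    ext j
    refine Fin.succAboveCases i ?_ (fun k => ?_) j
    · simp [g, mul_assoc, hc]
    · simp [g]
  rw [LinearMap.comp_apply, hg, map_sub, map_smul, LinearMap.mem_ker.mp hx, smul_zero, sub_zero]

/-- Finitely generated modules over Noetherian local rings have minimal free resolutions. -/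
theorem nonempty_minimalFreeResolution [IsNoetherianRing R] [Module.Finite R M] :
    Nonempty (MinimalFreeResolution R M) := by
  obtain ⟨n, f, hf, hker⟩ := exists_minimal_free_cover R M
  have step : ∀ s : Σ n : ℕ, Submodule R (Fin n → R),
      ∃ (m : ℕ) (g : (Fin m → R) →ₗ[R] (Fin s.1 → R)), LinearMap.range g = s.2 ∧
        LinearMap.ker g ≤ maximalIdeal R • (⊤ : Submodule R (Fin m → R)) := by
    rintro ⟨n, K⟩
    obtain ⟨m, g, hg, hgk⟩ := exists_minimal_free_cover R K
    refine ⟨m, K.subtype ∘ₗ g, ?_, ?_⟩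
    · rw [LinearMap.range_comp, LinearMap.range_eq_top.mpr hg, Submodule.map_top,
        Submodule.range_subtype]
    · rwa [LinearMap.ker_comp, Submodule.ker_subtype]
  choose m g hrange hgker using step
  let s : ℕ → Σ n : ℕ, Submodule R (Fin n → R) := fun i =>
    Nat.rec ⟨n, LinearMap.ker f⟩ (fun _ t => ⟨m t, LinearMap.ker (g t)⟩) i
  have hs : ∀ i, (s i).2 ≤ maximalIdeal R • (⊤ : Submodule R (Fin (s i).1 → R)) := by
    intro i
    cases i with
    | zero => exact hker
    | succ i => exact hgker (s i)
  exact ⟨{ rank := fun i => (s i).1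
           aug := f
           d := fun i => g (s i)
           aug_surjective := hf
           exact_aug := LinearMap.exact_iff.mpr (hrange (s 0)).symm
           exact := fun i => LinearMap.exact_iff.mpr (hrange (s (i + 1))).symm
           minimal := fun i => (hrange (s i)).le.trans (hs i) }⟩

/-- The Betti number `β_i(M)`: the rank of the `i`-th free module in a minimal free resolution
of `M` (which does not depend on the resolution, as minimal free resolutions are isomorphic). -/
noncomputable def bettiNumber [IsNoetherianRing R] [Module.Finite R M] (i : ℕ) : ℕ :=
  (Classical.choice (nonempty_minimalFreeResolution R M)).rank i

end Resolutions

/-- The depth of a local ring: the supremum of the lengths of the regular sequences in its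
maximal ideal. -/
noncomputable def localRingDepth (R : Type u) [CommRing R] [IsLocalRing R] : ℕ∞ :=
  ⨆ (rs : List R) (_ : RingTheory.Sequence.IsRegular R rs ∧ ∀ r ∈ rs, r ∈ maximalIdeal R),
    (rs.length : ℕ∞)

/-- A Cohen-Macaulay local ring: a Noetherian local ring whose depth is its Krull dimension. -/
structure IsCohenMacaulayLocalRing (R : Type u) [CommRing R] [IsLocalRing R] : Prop where
  isNoetherianRing : IsNoetherianRing R
  depth_eq_dim : (localRingDepth R : WithBot ℕ∞) = ringKrullDim R

/-- The grade of a module, `inf {i | Ext^i_R(M, R) ≠ 0}`. -/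
noncomputable def moduleGrade (R : Type u) [CommRing R]
    (M : Type u) [AddCommGroup M] [Module R M] : ℕ∞ :=
  ⨅ (i : ℕ) (_ : Nontrivial (Abelian.Ext (ModuleCat.of R M) (ModuleCat.of R R) i)), (i : ℕ∞)

/-- A (finitely generated) module is perfect if its projective dimension is finite and equal to
its grade. Since the projective dimension of `0` is `⊥`, perfect modules are nonzero. -/
def IsPerfectModule (R : Type u) [CommRing R]
    (M : Type u) [AddCommGroup M] [Module R M] : Prop :=
  ∃ p : ℕ, projectiveDimension (ModuleCat.of R M) = p ∧ moduleGrade R M = p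

/-- `N` is locally free on the punctured spectrum: `N_𝔭` is free over `R_𝔭` for every
prime `𝔭 ≠ 𝔪`. -/
def IsLocallyFreeOnPuncturedSpectrum (R : Type u) [CommRing R] [IsLocalRing R]
    (N : Type u) [AddCommGroup N] [Module R N] : Prop :=
  ∀ p : PrimeSpectrum R, p ≠ closedPoint R →
    Module.Free (Localization.AtPrime p.asIdeal) (LocalizedModule.AtPrime p.asIdeal N)

/-- The rank of `N_𝔭` over `R_𝔭` is the same for all primes `𝔭 ≠ 𝔪`. -/
def HasConstantRankOnPuncturedSpectrum (R : Type u) [CommRing R] [IsLocalRing R]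
    (N : Type u) [AddCommGroup N] [Module R N] : Prop :=
  ∃ r : ℕ, ∀ p : PrimeSpectrum R, p ≠ closedPoint R → Module.rankAtStalk N p = r

/-- `h^i(M)`, the length of the local cohomology module `H^i_𝔪(M)` (`⊤` if it is infinite). -/
noncomputable def localCohomologyLength (R : Type u) [CommRing R] [IsLocalRing R]
    (M : Type u) [AddCommGroup M] [Module R M] (i : ℕ) : ℕ∞ :=
  Module.length R ((localCohomology (maximalIdeal R) i).obj (ModuleCat.of R M))

/-! Take the minimal free resolution `F` of `M` and tensor it with `N`. The homology of `F ⊗ N` in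
positive degrees is killed by a power of `𝔪`: local freeness makes multiplication by each element of
some `𝔪 ^ n` on `N` factor through a free module, and tensoring with a free module keeps `F` exact.
Such homology has no local cohomology in positive degrees, so at each spot `H^{i+1}` of the
boundaries surjects onto `H^{i+1}` of the cycles. With the long exact sequence of cycles, chains and
boundaries this gives `h^i(Y_{j-1}) ≤ h^i(F_j ⊗ N) + h^{i+1}(Y_j)` for the images `Y_j` of the
tensored differentials (`length_range_rTensor_le`). Telescoping from `M ⊗ N` leaves a remainder at
`Y_p`, which is zero because minimality and `pd M = p` force `d_p = 0` (`d_eq_zero`). The inequality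
holds in `ℕ∞`, so finiteness is a separate matter.

For finiteness, perfection gives `dim M + p ≤ dim R = depth R`, so every degree `j + i` with `j ≤ p`
lies below the depth (`add_lt_localRingDepth`), where free modules have no local cohomology. Hence a
power of `𝔪` kills `H^k(N)` in these degrees, and an induction on regular elements turns this into
finite length (`length_ne_top_of_isPowTorsion`).

All of this is done on `LC`, a direct limit of `Abelian.Ext` groups, where long exact sequences are
composition with extension classes; `LocalCohomology.equiv` identifies it with `localCohomology`. -/

/-! ### Comparison of the derived-functor `Ext` with `Abelian.Ext` -/

section ExtComparison

open Limits Opposite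

variable {R : Type u} [CommRing R]

/-- The map of complexes of homomorphisms into `Y` induced by a map of chain complexes. -/
noncomputable def ChainComplex.linearYonedaMap {K L : ChainComplex (ModuleCat.{u} R) ℕ}
    (φ : K ⟶ L) (Y : ModuleCat.{u} R) :
    L.linearYonedaObj R Y ⟶ K.linearYonedaObj R Y :=
  (HomologicalComplex.unopFunctor _ _).map
    (((((linearYoneda R (ModuleCat.{u} R)).obj Y).rightOp.mapHomologicalComplex _).map φ).op)

/-- The derived-functor `Ext` is a left derived functor valued in the opposite category; this
bookkeeping carries naturality squares back from there. -/
theorem CategoryTheory.unop_square {D : Type*} [Category* D] {A A' B B' : Dᵒᵖ} {H H' : D}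
    (m : A ⟶ A') (e : A ≅ B) (e' : A' ≅ B') (g : B ⟶ B') (h : e.inv ≫ m = g ≫ e'.inv)
    (t : B ≅ op H) (t' : B' ≅ op H') (ψ : H' ⟶ H) (h' : g ≫ t'.hom = t.hom ≫ ψ.op) :
    m.unop ≫ e.inv.unop ≫ t.inv.unop = (e'.inv.unop ≫ t'.inv.unop) ≫ ψ := by
  apply Quiver.Hom.op_inj
  change (t.inv ≫ e.inv) ≫ m = ψ.op ≫ t'.inv ≫ e'.inv
  rw [Category.assoc, h, ← Category.assoc, ← Category.assoc]
  congr 1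
  rw [Iso.inv_comp_eq, ← Category.assoc, Iso.eq_comp_inv, h']

namespace CategoryTheory.ProjectiveResolution

variable {X X' : ModuleCat.{u} R} (P : ProjectiveResolution X) (P' : ProjectiveResolution X')
  (Y : ModuleCat.{u} R)

variable {P P'} in
theorem isoExt_hom_naturality {f : X ⟶ X'} (φ : Hom P P' f) (n : ℕ) :
    ((Ext R (ModuleCat.{u} R) n).map f.op).app Y ≫ (P.isoExt n Y).hom =
      (P'.isoExt n Y).hom ≫
        HomologicalComplex.homologyMap (ChainComplex.linearYonedaMap φ.hom Y) n := by
  exact unop_square _ (P.isoLeftDerivedObj _ n) (P'.isoLeftDerivedObj _ n) _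
    (isoLeftDerivedObj_inv_naturality f P P' φ.hom
      (by simpa using φ.hom_f_zero_comp_π_f_zero)
      ((linearYoneda R (ModuleCat.{u} R)).obj Y).rightOp n)
    (HomologicalComplex.homologyOp (P.complex.linearYonedaObj R Y) n)
    (HomologicalComplex.homologyOp (P'.complex.linearYonedaObj R Y) n)
    (HomologicalComplex.homologyMap (ChainComplex.linearYonedaMap φ.hom Y) n)
    (HomologicalComplex.homologyOp_hom_naturality
      (φ := ChainComplex.linearYonedaMap φ.hom Y) n)

variable {Y}

theorem comp_eq_zero_of_cycle (n : ℕ) (z : (P.complex.linearYonedaObj R Y).cycles n) :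
    P.complex.d (n + 1) n ≫
      (show P.complex.X n ⟶ Y from (P.complex.linearYonedaObj R Y).iCycles n z) = 0 :=
  congr($((P.complex.linearYonedaObj R Y).iCycles_d n (n + 1)) z)

theorem smul_extMk {n : ℕ} (r : R) (f : P.complex.X n ⟶ Y) (m : ℕ) (hm : n + 1 = m)
    (hf : P.complex.d m n ≫ f = 0) :
    r • P.extMk f m hm hf = P.extMk (r • f) m hm (by simp [hf]) := by
  rw [Abelian.Ext.smul_eq_comp_mk₀, extMk_comp_mk₀]
  congr 1

/-- The class in `Ext X Y n` of a cocycle. -/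
noncomputable def cyclesToExt (n : ℕ) :
    (P.complex.linearYonedaObj R Y).cycles n →ₗ[R] Abelian.Ext X Y n where
  toFun z := P.extMk _ (n + 1) rfl (P.comp_eq_zero_of_cycle n z)
  map_add' z w := by
    rw [add_extMk]
    congr 1
    exact map_add ((P.complex.linearYonedaObj R Y).iCycles n).hom _ _
  map_smul' r z := by
    rw [RingHom.id_apply, smul_extMk]
    congr 1
    exact map_smul ((P.complex.linearYonedaObj R Y).iCycles n).hom _ _

theorem exists_cycle (n : ℕ) (f : P.complex.X n ⟶ Y) (hf : P.complex.d (n + 1) n ≫ f = 0) :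
    ∃ z, (P.complex.linearYonedaObj R Y).iCycles n z = f := by
  have h : Function.Exact ((P.complex.linearYonedaObj R Y).iCycles n)
      ((P.complex.linearYonedaObj R Y).d n (n + 1)) :=
    (ShortComplex.ShortExact.moduleCat_exact_iff_function_exact _).mp
      (ShortComplex.exact_of_f_is_kernel
        (.mk _ _ ((P.complex.linearYonedaObj R Y).iCycles_d n (n + 1)))
        ((P.complex.linearYonedaObj R Y).cyclesIsKernel n (n + 1) (by simp)))
  exact (h f).mp hf

theorem cyclesToExt_surjective (n : ℕ) : Function.Surjective (P.cyclesToExt (Y := Y) n) := by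
  intro α
  obtain ⟨f, hf, rfl⟩ := P.extMk_surjective α (n + 1) rfl
  obtain ⟨z, rfl⟩ := P.exists_cycle n f hf
  exact ⟨z, rfl⟩

/-- As a cochain complex the resolution lives in degrees `≤ 0`, so a coboundary in this case would
factor through the zero object in degree `1`. -/
theorem extMk_zero_eq_zero_iff (f : P.complex.X 0 ⟶ Y) (hf : P.complex.d 1 0 ≫ f = 0) :
    P.extMk f 1 rfl hf = 0 ↔ f = 0 := by
  refine ⟨fun h => ?_, fun h => by subst h; simp⟩
  have h' := congrArg P.extEquivCohomologyClass h
  rw [extEquivCohomologyClass_extMk, extEquivCohomologyClass_zero,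
    CochainComplex.HomComplex.CohomologyClass.mk_eq_zero_iff,
    CochainComplex.HomComplex.Cocycle.toSingleMk_mem_coboundaries_iff _ _ _ _ _ 1 (by lia)] at h'
  obtain ⟨g, hg⟩ := h'
  have hz : IsZero (P.cochainComplex.X 1) := P.cochainComplex.isZero_of_isStrictlyLE 0 1 (by simp)
  rw [hz.eq_of_src g 0, comp_zero] at hg
  simpa using hg.symm

theorem homologyπ_eq_zero_iff (n : ℕ) (z : (P.complex.linearYonedaObj R Y).cycles (n + 1)) :
    (P.complex.linearYonedaObj R Y).homologyπ (n + 1) z = 0 ↔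
      ∃ g : P.complex.X n ⟶ Y, P.complex.d (n + 1) n ≫ g =
        (P.complex.linearYonedaObj R Y).iCycles (n + 1) z := by
  have h : Function.Exact ((P.complex.linearYonedaObj R Y).toCycles n (n + 1))
      ((P.complex.linearYonedaObj R Y).homologyπ (n + 1)) :=
    (ShortComplex.ShortExact.moduleCat_exact_iff_function_exact _).mp
      (ShortComplex.exact_of_g_is_cokernel
        (.mk _ _ ((P.complex.linearYonedaObj R Y).toCycles_comp_homologyπ n (n + 1)))
        ((P.complex.linearYonedaObj R Y).homologyIsCokernel n (n + 1) (by simp)))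
  rw [h z]
  have hinj : Function.Injective ((P.complex.linearYonedaObj R Y).iCycles (n + 1)) :=
    (ModuleCat.mono_iff_injective _).mp inferInstance
  refine exists_congr fun g => ?_
  rw [← hinj.eq_iff]
  rw [← ConcreteCategory.comp_apply, HomologicalComplex.toCycles_i]
  rfl

theorem cyclesToExt_eq_zero_iff (n : ℕ) (z : (P.complex.linearYonedaObj R Y).cycles n) :
    P.cyclesToExt n z = 0 ↔ (P.complex.linearYonedaObj R Y).homologyπ n z = 0 := by
  obtain _ | n := n
  · refine (P.extMk_zero_eq_zero_iff _ (P.comp_eq_zero_of_cycle 0 z)).trans ?_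
    have h1 : Function.Injective ((P.complex.linearYonedaObj R Y).iCycles 0) :=
      (ModuleCat.mono_iff_injective _).mp inferInstance
    have := (P.complex.linearYonedaObj R Y).isIso_homologyπ 0 0 (by simp) (by simp)
    have h2 : Function.Injective ((P.complex.linearYonedaObj R Y).homologyπ 0) :=
      (ModuleCat.mono_iff_injective _).mp inferInstance
    rw [map_eq_zero_iff _ h2]
    exact map_eq_zero_iff _ h1
  · exact (P.extMk_eq_zero_iff _ _ rfl (P.comp_eq_zero_of_cycle (n + 1) z) n rfl).trans
      (P.homologyπ_eq_zero_iff n z).symm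

theorem homologyπ_surjective (n : ℕ) :
    Function.Surjective ((P.complex.linearYonedaObj R Y).homologyπ n) :=
  (ModuleCat.epi_iff_surjective _).mp inferInstance

variable (Y) in
/-- The homology of the complex of homomorphisms from a projective resolution computes `Ext`. -/
noncomputable def homologyEquivExt (n : ℕ) :
    (P.complex.linearYonedaObj R Y).homology n ≃ₗ[R] Abelian.Ext X Y n :=
  ((((P.complex.linearYonedaObj R Y).homologyπ n).hom.quotKerEquivOfSurjective
    (P.homologyπ_surjective n)).symm ≪≫ₗ
    Submodule.quotEquivOfEq _ _ (by
      ext z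
      exact (P.cyclesToExt_eq_zero_iff n z).symm)) ≪≫ₗ
    (P.cyclesToExt n).quotKerEquivOfSurjective (P.cyclesToExt_surjective n)

theorem homologyEquivExt_homologyπ (n : ℕ) (z : (P.complex.linearYonedaObj R Y).cycles n) :
    P.homologyEquivExt Y n ((P.complex.linearYonedaObj R Y).homologyπ n z) =
      P.cyclesToExt n z := by
  have h : (((P.complex.linearYonedaObj R Y).homologyπ n).hom.quotKerEquivOfSurjective
      (P.homologyπ_surjective n)).symm ((P.complex.linearYonedaObj R Y).homologyπ n z) =
        Submodule.Quotient.mk z := by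
    rw [LinearEquiv.symm_apply_eq]
    rfl
  simp only [homologyEquivExt, LinearEquiv.trans_apply]
  rw [h]
  rfl

variable {P P'} in
theorem homologyEquivExt_naturality {f : X ⟶ X'} (φ : Hom P P' f) (n : ℕ)
    (x : (P'.complex.linearYonedaObj R Y).homology n) :
    P.homologyEquivExt Y n
        (HomologicalComplex.homologyMap (ChainComplex.linearYonedaMap φ.hom Y) n x) =
      (Abelian.Ext.mk₀ f).comp (P'.homologyEquivExt Y n x) (zero_add n) := by
  obtain ⟨z, rfl⟩ := P'.homologyπ_surjective n x
  rw [← ConcreteCategory.comp_apply, HomologicalComplex.homologyπ_naturality,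
    ConcreteCategory.comp_apply, homologyEquivExt_homologyπ, homologyEquivExt_homologyπ]
  refine Eq.trans ?_ (mk₀_comp_extMk _ (n + 1) rfl (P'.comp_eq_zero_of_cycle n z) φ).symm
  simp only [cyclesToExt, LinearMap.coe_mk, AddHom.coe_mk]
  congr 1
  exact congr($(HomologicalComplex.cyclesMap_i (ChainComplex.linearYonedaMap φ.hom Y) n) z)

end CategoryTheory.ProjectiveResolution

namespace CategoryTheory

/-- The two definitions of `Ext` agree. -/
noncomputable def extEquivExt (X Y : ModuleCat.{u} R) (n : ℕ) :
    ((Ext R (ModuleCat.{u} R) n).obj (op X)).obj Y ≃ₗ[R] Abelian.Ext X Y n :=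
  ((projectiveResolution X).isoExt n Y).toLinearEquiv ≪≫ₗ
    (projectiveResolution X).homologyEquivExt Y n

theorem extEquivExt_naturality {X X' : ModuleCat.{u} R} (f : X ⟶ X') (Y : ModuleCat.{u} R) (n : ℕ)
    (x : ((Ext R (ModuleCat.{u} R) n).obj (op X')).obj Y) :
    extEquivExt X Y n (((Ext R (ModuleCat.{u} R) n).map f.op).app Y x) =
      (Abelian.Ext.mk₀ f).comp (extEquivExt X' Y n x) (zero_add n) := by
  let φ : (projectiveResolution X).Hom (projectiveResolution X') f :=
    { hom := ProjectiveResolution.lift f _ _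
      hom_f_zero_comp_π_f_zero := by
        rw [← HomologicalComplex.comp_f, ← HomologicalComplex.comp_f,
          ProjectiveResolution.lift_commutes] }
  have h := ProjectiveResolution.isoExt_hom_naturality Y φ n
  refine Eq.trans ?_ (ProjectiveResolution.homologyEquivExt_naturality φ n _)
  exact congrArg ((projectiveResolution X).homologyEquivExt Y n) congr($h x)

end CategoryTheory

end ExtComparison

/-! ### Local cohomology as a direct limit of `Abelian.Ext` groups -/

section DirectLimit

open Limits Opposite

variable {R : Type u} [CommRing R] (J : Ideal R)

namespace LocalCohomology

/-- The projection `R ⧸ J ^ m → R ⧸ J ^ n` for `n ≤ m`. -/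
noncomputable def proj {n m : ℕ} (h : n ≤ m) :
    ModuleCat.of R (R ⧸ J ^ m) ⟶ ModuleCat.of R (R ⧸ J ^ n) :=
  ModuleCat.ofHom (Submodule.mapQ (J ^ m) (J ^ n) LinearMap.id (Ideal.pow_le_pow_right h))

theorem proj_self (n : ℕ) : proj J (le_refl n) = 𝟙 _ := by
  ext
  rfl

theorem proj_comp {n m k : ℕ} (h : n ≤ m) (h' : m ≤ k) :
    proj J h' ≫ proj J h = proj J (h.trans h') := by
  ext
  rfl

variable (L : Type u) [AddCommGroup L] [Module R L]

/-- The modules `Ext^i(R ⧸ J ^ n, L)`. -/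
abbrev extPow (i n : ℕ) : Type u :=
  Abelian.Ext (ModuleCat.of R (R ⧸ J ^ n)) (ModuleCat.of R L) i

/-- The transition maps between the modules `Ext^i(R ⧸ J ^ n, L)`. -/
noncomputable def extPowMap (i n m : ℕ) (h : n ≤ m) : extPow J L i n →ₗ[R] extPow J L i m :=
  Abelian.Ext.precompOfLinear (Abelian.Ext.mk₀ (proj J h)) R _ (zero_add i)

variable {L} in
theorem extPowMap_apply {i n m : ℕ} (h : n ≤ m) (e : extPow J L i n) :
    extPowMap J L i n m h e = (Abelian.Ext.mk₀ (proj J h)).comp e (zero_add i) :=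
  rfl

instance (i : ℕ) : DirectedSystem (extPow J L i) (extPowMap J L i · · ·) where
  map_self n e := by rw [extPowMap_apply, proj_self, Abelian.Ext.mk₀_id_comp]
  map_map n m k h h' e := by
    rw [extPowMap_apply, extPowMap_apply, extPowMap_apply, Abelian.Ext.mk₀_comp_mk₀_assoc,
      proj_comp]

end LocalCohomology

open LocalCohomology

/-- Local cohomology as the direct limit of the modules `Ext^i(R ⧸ J ^ n, L)`. -/
abbrev LC (i : ℕ) (L : Type u) [AddCommGroup L] [Module R L] : Type u :=
  Module.DirectLimit (extPow J L i) (extPowMap J L i)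

namespace LocalCohomology

variable (L : Type u) [AddCommGroup L] [Module R L]

/-- The cocone defining local cohomology, evaluated at a module. -/
noncomputable def evalCocone (i : ℕ) :=
  ((evaluation (ModuleCat.{u} R) (ModuleCat.{u} R)).obj (ModuleCat.of R L)).mapCocone
    (colimit.cocone (localCohomology.diagram (localCohomology.idealPowersDiagram J) i))

/-- The cocone defining local cohomology, evaluated at a module, is a colimit. -/
noncomputable def isColimitEvalCocone (i : ℕ) : IsColimit (evalCocone J L i) :=
  isColimitOfPreserves _ (colimit.isColimit _)

/-- The maps `Ext^i(R ⧸ J ^ n, L) → H^i_J(L)`. -/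
noncomputable def toLocalCohomology (i n : ℕ) :
    extPow J L i n →ₗ[R] (localCohomology J i).obj (ModuleCat.of R L) :=
  ((evalCocone J L i).ι.app (op (op n))).hom ∘ₗ (extEquivExt _ _ i).symm.toLinearMap

theorem toLocalCohomology_extEquivExt (i n : ℕ)
    (x : ((Ext R (ModuleCat.{u} R) i).obj (op (ModuleCat.of R (R ⧸ J ^ n)))).obj
      (ModuleCat.of R L)) :
    toLocalCohomology J L i n (extEquivExt _ _ i x) = (evalCocone J L i).ι.app (op (op n)) x :=
  congrArg ((evalCocone J L i).ι.app (op (op n))) ((extEquivExt _ _ i).symm_apply_apply x)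

theorem toLocalCohomology_extPowMap (i : ℕ) {n m : ℕ} (h : n ≤ m) (e : extPow J L i n) :
    toLocalCohomology J L i m (extPowMap J L i n m h e) = toLocalCohomology J L i n e := by
  obtain ⟨x, rfl⟩ := (extEquivExt _ _ i).surjective e
  rw [extPowMap_apply, ← extEquivExt_naturality]
  rw [toLocalCohomology_extEquivExt, toLocalCohomology_extEquivExt]
  exact congr($((evalCocone J L i).w (homOfLE h).op.op) x)

theorem exists_extPowMap_eq_zero (i : ℕ) {n : ℕ} (e : extPow J L i n)
    (h : toLocalCohomology J L i n e = 0) : ∃ m, ∃ h : n ≤ m, extPowMap J L i n m h e = 0 := by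
  -- The diagram is indexed by `ℕ`, in universe `0`, so preservation of filtered colimits has to be
  -- lowered from size `u`.
  have := preservesFilteredColimitsOfSize_shrink.{0, u, 0, u} (forget (ModuleCat.{u} R))
  obtain ⟨x, rfl⟩ := (extEquivExt _ _ i).surjective e
  rw [toLocalCohomology_extEquivExt] at h
  obtain ⟨k, f, g, h⟩ := Concrete.isColimit_exists_of_rep_eq _ (isColimitEvalCocone J L i)
    (i := op (op n)) (j := op (op n)) x 0 (h.trans (map_zero _).symm)
  refine ⟨k.unop.unop, leOfHom f.unop.unop, ?_⟩
  rw [extPowMap_apply, ← extEquivExt_naturality, LinearEquiv.map_eq_zero_iff]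
  exact h.trans (map_zero _)

theorem exists_toLocalCohomology_eq (i : ℕ) (y : (localCohomology J i).obj (ModuleCat.of R L)) :
    ∃ n e, toLocalCohomology J L i n e = y := by
  have := preservesFilteredColimitsOfSize_shrink.{0, u, 0, u} (forget (ModuleCat.{u} R))
  obtain ⟨k, x, rfl⟩ := Concrete.isColimit_exists_rep _ (isColimitEvalCocone J L i) y
  exact ⟨k.unop.unop, extEquivExt _ _ i x, toLocalCohomology_extEquivExt J L i _ x⟩

/-- Local cohomology is the direct limit of the modules `Ext^i(R ⧸ J ^ n, L)`. -/
noncomputable def equiv (i : ℕ) :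
    LC J i L ≃ₗ[R] (localCohomology J i).obj (ModuleCat.of R L) :=
  LinearEquiv.ofBijective
    (Module.DirectLimit.lift R ℕ _ _ (toLocalCohomology J L i)
      fun _ _ h e => toLocalCohomology_extPowMap J L i h e) <| by
    constructor
    · rw [injective_iff_map_eq_zero]
      intro x hx
      obtain ⟨n, e, rfl⟩ := Module.DirectLimit.exists_of x
      rw [Module.DirectLimit.lift_of] at hx
      obtain ⟨m, h, he⟩ := exists_extPowMap_eq_zero J L i e hx
      rw [← Module.DirectLimit.of_f (hij := h), he, map_zero]
    · intro y
      obtain ⟨n, e, rfl⟩ := exists_toLocalCohomology_eq J L i y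
      exact ⟨Module.DirectLimit.of R ℕ _ _ n e, Module.DirectLimit.lift_of _ _ _⟩

end LocalCohomology

end DirectLimit

/-! ### Functoriality, long exact sequence and torsion -/

section LongExactSequence

variable {R : Type u} [CommRing R] (J : Ideal R)
variable {A B C : Type u} [AddCommGroup A] [Module R A] [AddCommGroup B] [Module R B]
  [AddCommGroup C] [Module R C]

namespace LocalCohomology

/-- The map on local cohomology induced by an element of `Ext`. -/
noncomputable def cup {a : ℕ} (i k : ℕ) (h : i + a = k)
    (β : Abelian.Ext (ModuleCat.of R A) (ModuleCat.of R B) a) : LC J i A →ₗ[R] LC J k B :=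
  Module.DirectLimit.map (fun n => Abelian.Ext.postcompOfLinear β R _ h) fun n m hnm => by
    ext e
    exact Abelian.Ext.comp_assoc _ _ _ (zero_add i) h (by lia)

/-- The class of an element of `Ext^i(R ⧸ J ^ n, A)` in local cohomology. -/
noncomputable def ofExt (i n : ℕ) : extPow J A i n →ₗ[R] LC J i A :=
  Module.DirectLimit.of R ℕ (extPow J A i) (extPowMap J A i) n

theorem cup_ofExt {a i k : ℕ} (h : i + a = k)
    (β : Abelian.Ext (ModuleCat.of R A) (ModuleCat.of R B) a) {n : ℕ} (e : extPow J A i n) :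
    cup J i k h β (ofExt J i n e) = ofExt J k n (e.comp β h) :=
  Module.DirectLimit.map_apply_of _ _ _

theorem exists_ofExt_eq {i : ℕ} (x : LC J i A) : ∃ n e, ofExt J i n e = x :=
  Module.DirectLimit.exists_of x

theorem ofExt_extPowMap {i n m : ℕ} (h : n ≤ m) (e : extPow J A i n) :
    ofExt J i m (extPowMap J A i n m h e) = ofExt J i n e :=
  Module.DirectLimit.of_f

theorem exists_extPowMap_eq_zero_of_ofExt_eq_zero {i n : ℕ} {e : extPow J A i n}
    (h : ofExt J i n e = 0) : ∃ m, ∃ h : n ≤ m, extPowMap J A i n m h e = 0 :=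
  Module.DirectLimit.of.zero_exact h

/-- A class that dies in the limit already dies at a finite stage, where exactness for `Ext`
applies; postcomposition commutes with the transition maps by associativity. -/
theorem cup_exact {a b c i k l : ℕ} (h : i + a = k) (h' : k + b = l)
    (α : Abelian.Ext (ModuleCat.of R A) (ModuleCat.of R B) a)
    (β : Abelian.Ext (ModuleCat.of R B) (ModuleCat.of R C) b)
    {hc : a + b = c} (hαβ : α.comp β hc = 0)
    (hex : ∀ (n : ℕ) (e : extPow J B k n), e.comp β h' = 0 →
      ∃ e' : extPow J A i n, e'.comp α h = e) :
    Function.Exact (cup J i k h α) (cup J k l h' β) := by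
  intro x
  constructor
  · intro hx
    obtain ⟨n, e, rfl⟩ := exists_ofExt_eq J x
    rw [cup_ofExt] at hx
    obtain ⟨m, hnm, he⟩ := exists_extPowMap_eq_zero_of_ofExt_eq_zero J hx
    obtain ⟨e', he'⟩ := hex m (extPowMap J B k n m hnm e)
      ((Abelian.Ext.comp_assoc _ _ _ (zero_add k) h' (by lia)).trans he)
    exact ⟨ofExt J i m e', by rw [cup_ofExt, he', ofExt_extPowMap]⟩
  · rintro ⟨y, rfl⟩
    obtain ⟨n, e, rfl⟩ := exists_ofExt_eq J y
    rw [cup_ofExt, cup_ofExt, Abelian.Ext.comp_assoc _ _ _ _ hc (by lia), hαβ,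
      Abelian.Ext.comp_zero, map_zero]

/-- The map on local cohomology induced by a linear map. -/
noncomputable def map (i : ℕ) (f : A →ₗ[R] B) : LC J i A →ₗ[R] LC J i B :=
  cup J i i (add_zero i) (Abelian.Ext.mk₀ (ModuleCat.ofHom f))

/-- The long exact sequence of local cohomology. -/
theorem exists_delta {f : A →ₗ[R] B} {g : B →ₗ[R] C} (hf : Function.Injective f)
    (hfg : Function.Exact f g) (hg : Function.Surjective g) (i : ℕ) :
    ∃ δ : LC J i C →ₗ[R] LC J (i + 1) A, Function.Exact (map J i f) (map J i g) ∧
      Function.Exact (map J i g) δ ∧ Function.Exact δ (map J (i + 1) f) := by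
  let S := ModuleCat.shortComplexOfCompEqZero f g hfg.linearMap_comp_eq_zero
  have hS : S.ShortExact := ModuleCat.shortComplex_shortExact S hfg hf hg
  have h1 : (Abelian.Ext.mk₀ (ModuleCat.ofHom f)).comp (Abelian.Ext.mk₀ (ModuleCat.ofHom g))
      (zero_add 0) = 0 := S.ext_mk₀_f_comp_ext_mk₀_g
  exact ⟨cup J i (i + 1) rfl hS.extClass,
    cup_exact J (add_zero i) (add_zero i) _ _ h1
      fun n e he => Abelian.Ext.covariant_sequence_exact₂ _ hS e he,
    cup_exact J (add_zero i) rfl _ _ hS.comp_extClass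
      fun n e he => Abelian.Ext.covariant_sequence_exact₃ _ hS e rfl he,
    cup_exact J rfl (add_zero (i + 1)) _ _ hS.extClass_comp
      fun n e he => Abelian.Ext.covariant_sequence_exact₁ _ hS e he rfl⟩

theorem map_comp (i : ℕ) (f : A →ₗ[R] B) (g : B →ₗ[R] C) (x : LC J i A) :
    map J i (g ∘ₗ f) x = map J i g (map J i f x) := by
  obtain ⟨n, e, rfl⟩ := exists_ofExt_eq J x
  simp only [map, cup_ofExt]
  rw [ModuleCat.ofHom_comp, ← Abelian.Ext.mk₀_comp_mk₀, ← Abelian.Ext.comp_assoc]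
  lia

theorem map_smul_id (i : ℕ) (r : R) (x : LC J i A) :
    map J i (r • LinearMap.id : A →ₗ[R] A) x = r • x := by
  obtain ⟨n, e, rfl⟩ := exists_ofExt_eq J x
  simp only [map, cup_ofExt]
  rw [← map_smul, Abelian.Ext.smul_eq_comp_mk₀]
  rfl

/-- Local cohomology modules are torsion. -/
theorem exists_pow_smul_eq_zero {i : ℕ} (x : LC J i A) : ∃ n, ∀ r ∈ J ^ n, r • x = 0 := by
  obtain ⟨n, e, rfl⟩ := exists_ofExt_eq J x
  refine ⟨n, fun r hr => ?_⟩
  -- The scalar `r` can be moved to the first argument of `Ext`, where it is zero on `R ⧸ J ^ n`.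
  have h0 : r • 𝟙 (ModuleCat.of R (R ⧸ J ^ n)) = 0 := by
    ext
    simpa [Algebra.smul_def] using Ideal.Quotient.eq_zero_iff_mem.mpr hr
  rw [← map_smul, ← Abelian.Ext.mk₀_id_comp (r • e), Abelian.Ext.comp_smul,
    ← Abelian.Ext.smul_comp, ← Abelian.Ext.mk₀_smul, h0, Abelian.Ext.mk₀_zero,
    Abelian.Ext.zero_comp, map_zero]

/-- Local cohomology in degree zero is a submodule. -/
theorem exists_injective_zero : ∃ f : LC J 0 A →ₗ[R] A, Function.Injective f := by
  -- A homomorphism out of `R ⧸ J ^ n` is determined by its value at the class of `1`, and these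
  -- values are compatible with the projections.
  let ev (n : ℕ) : extPow J A 0 n →ₗ[R] A :=
    { toFun e := (Abelian.Ext.linearEquiv₀ (R := R) e).hom (Ideal.Quotient.mk _ 1 : R ⧸ J ^ n)
      map_add' e e' := by rw [map_add]; rfl
      map_smul' r e := by rw [map_smul]; rfl }
  have hev {n m : ℕ} (h : n ≤ m) (e : extPow J A 0 n) :
      ev m (extPowMap J A 0 n m h e) = ev n e := by
    obtain ⟨f, rfl⟩ := (Abelian.Ext.linearEquiv₀ (R := R)).symm.surjective e
    have h' : extPowMap J A 0 n m h ((Abelian.Ext.linearEquiv₀ (R := R)).symm f) =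
        (Abelian.Ext.linearEquiv₀ (R := R)).symm (proj J h ≫ f) :=
      Abelian.Ext.mk₀_comp_mk₀ _ _
    rw [h']
    simp only [ev, LinearMap.coe_mk, AddHom.coe_mk, LinearEquiv.apply_symm_apply]
    rfl
  refine ⟨Module.DirectLimit.lift R ℕ _ _ ev fun _ _ h e => hev h e, ?_⟩
  refine Module.DirectLimit.lift_injective _ _ fun n => ?_
  rw [injective_iff_map_eq_zero]
  intro e he
  rw [← (Abelian.Ext.linearEquiv₀ (R := R)).map_eq_zero_iff]
  ext
  exact he

end LocalCohomology

end LongExactSequence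

/-! ### Vanishing on modules killed by a power of the ideal -/

section Vanishing

variable {R : Type u} [CommRing R] (J : Ideal R)
variable {L : Type u} [AddCommGroup L] [Module R L]

/-- Dimension shifting: `e` comes from `e'` through the connecting map, and naturality of the
extension class transfers the vanishing. -/
theorem CategoryTheory.ShortComplex.ShortExact.mk₀_comp_eq_zero
    {S' S : ShortComplex (ModuleCat.{u} R)} (hS' : S'.ShortExact) (hS : S.ShortExact)
    (φ : S' ⟶ S) {Y : ModuleCat.{u} R} {i k : ℕ} (hi : 1 + i = k) (e : Abelian.Ext S.X₃ Y k)
    (e' : Abelian.Ext S.X₁ Y i) (he : hS.extClass.comp e' hi = e)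
    (h : (Abelian.Ext.mk₀ φ.τ₁).comp e' (zero_add i) = 0) :
    (Abelian.Ext.mk₀ φ.τ₃).comp e (zero_add k) = 0 := by
  rw [← he, ← Abelian.Ext.comp_assoc _ _ _ (zero_add 1) hi (by lia),
    ← ShortComplex.ShortExact.extClass_naturality hS' hS φ,
    Abelian.Ext.comp_assoc _ _ _ (add_zero 1) (zero_add i) (by lia), h, Abelian.Ext.comp_zero]

/-- The restriction of a class in `Ext^i(A, L)` to a submodule of `A`. -/
noncomputable abbrev extRestrict {A : Type u} [AddCommGroup A] [Module R A] (P : Submodule R A)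
    {i : ℕ} (e : Abelian.Ext (ModuleCat.of R A) (ModuleCat.of R L) i) :
    Abelian.Ext (ModuleCat.of R P) (ModuleCat.of R L) i :=
  (Abelian.Ext.mk₀ (ModuleCat.ofHom P.subtype)).comp e (zero_add i)

theorem mk₀_comp_eq_zero_of_extRestrict_eq_zero {A B : Type u} [AddCommGroup A] [Module R A]
    [AddCommGroup B] [Module R B] {P : Submodule R A} {i : ℕ}
    {e : Abelian.Ext (ModuleCat.of R A) (ModuleCat.of R L) i} (h : extRestrict P e = 0)
    (f : B →ₗ[R] A) (hf : ∀ x, f x ∈ P) :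
    (Abelian.Ext.mk₀ (ModuleCat.ofHom f)).comp e (zero_add i) = 0 := by
  have : ModuleCat.ofHom f = ModuleCat.ofHom (f.codRestrict P hf) ≫ ModuleCat.ofHom P.subtype := by
    ext
    rfl
  rw [this, ← Abelian.Ext.mk₀_comp_mk₀, Abelian.Ext.comp_assoc _ _ _ (zero_add 0) (zero_add i)
    (by lia)]
  rw [show (Abelian.Ext.mk₀ (ModuleCat.ofHom P.subtype)).comp e (zero_add i) = 0 from h,
    Abelian.Ext.comp_zero]

/-- By the Artin-Rees lemma, classes in `Ext^i(A, L)` with `L` killed by a power of `J` vanish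
on `J ^ n A` for large `n`. -/
theorem exists_extRestrict_eq_zero [IsNoetherianRing R] {t : ℕ}
    (hL : ∀ r ∈ J ^ t, ∀ x : L, r • x = 0) (i : ℕ) {A : Type u} [AddCommGroup A] [Module R A]
    [Module.Finite R A] (e : Abelian.Ext (ModuleCat.of R A) (ModuleCat.of R L) i) :
    ∃ n : ℕ, extRestrict (J ^ n • (⊤ : Submodule R A)) e = 0 := by
  induction i generalizing A with
  | zero =>
    obtain ⟨f, rfl⟩ := (Abelian.Ext.linearEquiv₀ (R := R)).symm.surjective e
    refine ⟨t, (Abelian.Ext.mk₀_comp_mk₀ _ _).trans ?_⟩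
    rw [Abelian.Ext.mk₀_eq_zero_iff]
    ext ⟨x, hx⟩
    change f.hom x = 0
    induction hx using Submodule.smul_induction_on' with
    | smul r hr x _ => rw [map_smul, hL r hr]
    | add x _ y _ hx hy => rw [map_add, hx, hy, add_zero]
  | succ i ih =>
    obtain ⟨k, π, hπ⟩ := Module.Finite.exists_fin' R A
    let S := π.shortComplexKer
    have hS : S.ShortExact := π.shortExact_shortComplexKer hπ
    have : Projective S.X₂ := inferInstanceAs (Projective (ModuleCat.of R (Fin k → R)))
    obtain ⟨e', he'⟩ := Abelian.Ext.contravariant_sequence_exact₃ hS _ e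
      (Abelian.Ext.eq_zero_of_projective (P := S.X₂) _) (add_comm 1 i)
    obtain ⟨n, hn⟩ := ih (A := LinearMap.ker π) e'
    -- Artin–Rees: `J ^ (n + c) F ∩ ker π ⊆ J ^ n ker π`, so the kernel of the restricted cover
    -- lands where `e'` vanishes.
    obtain ⟨c, hc⟩ := Ideal.exists_pow_inf_eq_pow_smul J (LinearMap.ker π)
    have hmap (x : Fin k → R) (hx : x ∈ J ^ (n + c) • (⊤ : Submodule R (Fin k → R))) :
        π x ∈ J ^ (n + c) • (⊤ : Submodule R A) := by
      have := Submodule.mem_map_of_mem (f := π) hx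
      rwa [Submodule.map_smul'', Submodule.map_top, LinearMap.range_eq_top.mpr hπ] at this
    let π' : ↥(J ^ (n + c) • (⊤ : Submodule R (Fin k → R))) →ₗ[R]
      ↥(J ^ (n + c) • (⊤ : Submodule R A)) := π.restrict hmap
    have hπ' : Function.Surjective π' := by
      rintro ⟨y, hy⟩
      have hy' := hy
      rw [← LinearMap.range_eq_top.mpr hπ, ← Submodule.map_top, ← Submodule.map_smul''] at hy'
      obtain ⟨x, hx, rfl⟩ := hy'
      exact ⟨⟨x, hx⟩, rfl⟩
    have hker (x : LinearMap.ker π') : (x : Fin k → R) ∈ LinearMap.ker π :=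
      congrArg Subtype.val x.2
    let τ : LinearMap.ker π' →ₗ[R] LinearMap.ker π :=
      LinearMap.codRestrict _ ((Submodule.subtype _) ∘ₗ (LinearMap.ker π').subtype) hker
    have hτ (x : LinearMap.ker π') :
        τ x ∈ J ^ n • (⊤ : Submodule R (LinearMap.ker π)) := by
      have hx : (x : Fin k → R) ∈ J ^ (n + c) • (⊤ : Submodule R (Fin k → R)) ⊓ LinearMap.ker π :=
        ⟨x.1.2, hker x⟩
      rw [hc _ (Nat.le_add_left c n), Nat.add_sub_cancel] at hx
      have hx' := Submodule.smul_mono le_rfl inf_le_right hx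
      have : (J ^ n • LinearMap.ker π : Submodule R (Fin k → R)) =
          (J ^ n • (⊤ : Submodule R (LinearMap.ker π))).map (LinearMap.ker π).subtype := by
        rw [Submodule.map_smul'', Submodule.map_top, Submodule.range_subtype]
      rw [this] at hx'
      obtain ⟨y, hy, hxy⟩ := hx'
      have : τ x = y := Subtype.ext hxy.symm
      rwa [this]
    let S' : ShortComplex (ModuleCat.{u} R) := π'.shortComplexKer
    have hS' : S'.ShortExact := π'.shortExact_shortComplexKer hπ'
    let φ : S' ⟶ S :=
      { τ₁ := ModuleCat.ofHom τ
        τ₂ := ModuleCat.ofHom (Submodule.subtype _)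
        τ₃ := ModuleCat.ofHom (Submodule.subtype _)
        comm₁₂ := rfl
        comm₂₃ := rfl }
    have h0 := mk₀_comp_eq_zero_of_extRestrict_eq_zero (A := LinearMap.ker π)
      (B := LinearMap.ker π') (e := e') hn τ hτ
    have h1 : (Abelian.Ext.mk₀ φ.τ₁).comp e' (zero_add i) = 0 := h0
    have h3 := ShortComplex.ShortExact.mk₀_comp_eq_zero hS' hS φ (add_comm 1 i) e e' he' h1
    exact ⟨n + c, h3⟩

/-- Local cohomology of modules killed by a power of the ideal vanishes in positive degrees. -/
theorem LocalCohomology.subsingleton_of_pow_smul_eq_zero [IsNoetherianRing R] {t : ℕ}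
    (hL : ∀ r ∈ J ^ t, ∀ x : L, r • x = 0) (i : ℕ) : Subsingleton (LC J (i + 1) L) := by
  refine subsingleton_of_forall_eq 0 fun x => ?_
  obtain ⟨n, e, rfl⟩ := exists_ofExt_eq J x
  let S (n : ℕ) : ShortComplex (ModuleCat.{u} R) :=
    ModuleCat.shortComplexOfCompEqZero (J ^ n).subtype (J ^ n).mkQ 
      (LinearMap.ext fun x => (Submodule.Quotient.mk_eq_zero _).mpr x.2)
  have hS (n : ℕ) : (S n).ShortExact := ModuleCat.shortComplex_shortExact _
    (LinearMap.exact_subtype_mkQ (J ^ n)) (Submodule.subtype_injective _) (Submodule.mkQ_surjective _)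
  have : Projective (S n).X₂ := inferInstanceAs (Projective (ModuleCat.of R R))
  obtain ⟨e', he'⟩ := Abelian.Ext.contravariant_sequence_exact₃ (hS n) _ e
    (Abelian.Ext.eq_zero_of_projective (P := (S n).X₂) _) (add_comm 1 i)
  obtain ⟨k, hk⟩ := exists_extRestrict_eq_zero J hL i (A := ↥(J ^ n)) e'
  -- Since `J ^ (n + k) = J ^ k * J ^ n`, the inclusion lands where `e'` vanishes; hence `e` dies at
  -- stage `n + k`.
  have hle : J ^ (n + k) ≤ J ^ n := Ideal.pow_le_pow_right (Nat.le_add_right n k)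
  let τ : ↥(J ^ (n + k)) →ₗ[R] ↥(J ^ n) := Submodule.inclusion hle
  have hτ (x : ↥(J ^ (n + k))) : τ x ∈ J ^ k • (⊤ : Submodule R ↥(J ^ n)) := by
    have hx : (x : R) ∈ (J ^ k • (⊤ : Submodule R ↥(J ^ n))).map (J ^ n).subtype := by
      rw [Submodule.map_smul'', Submodule.map_top, Submodule.range_subtype, smul_eq_mul, ← pow_add,
        add_comm]
      exact x.2
    obtain ⟨y, hy, hxy⟩ := hx
    have : τ x = y := Subtype.ext hxy.symm
    rwa [this]
  let φ : S (n + k) ⟶ S n :=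
    { τ₁ := ModuleCat.ofHom τ
      τ₂ := 𝟙 _
      τ₃ := proj J (Nat.le_add_right n k)
      comm₁₂ := rfl
      comm₂₃ := rfl }
  have h1 : (Abelian.Ext.mk₀ φ.τ₁).comp e' (zero_add i) = 0 :=
    mk₀_comp_eq_zero_of_extRestrict_eq_zero hk τ hτ
  have h3 := ShortComplex.ShortExact.mk₀_comp_eq_zero (hS (n + k)) (hS n) φ (add_comm 1 i) e e'
    he' h1
  have h4 : extPowMap J L (i + 1) n (n + k) (Nat.le_add_right n k) e = 0 := h3
  rw [← ofExt_extPowMap J (Nat.le_add_right n k), h4, map_zero]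

end Vanishing

/-! ### Modules killed by a power of an ideal -/

section Torsion

variable {R : Type u} [CommRing R]

/-- Every element of the module `L` is killed by a fixed power of the ideal `J`. -/
def IsPowTorsion (J : Ideal R) (L : Type*) [AddCommGroup L] [Module R L] : Prop :=
  ∃ n, ∀ r ∈ J ^ n, ∀ x : L, r • x = 0

variable {J : Ideal R}
variable {A B C : Type*} [AddCommGroup A] [Module R A] [AddCommGroup B] [Module R B]
  [AddCommGroup C] [Module R C]

theorem IsPowTorsion.of_subsingleton [Subsingleton A] : IsPowTorsion J A :=
  ⟨0, fun _ _ _ => Subsingleton.elim _ _⟩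

theorem IsPowTorsion.of_exact (hA : IsPowTorsion J A) (hC : IsPowTorsion J C) (f : A →ₗ[R] B)
    (g : B →ₗ[R] C) (h : Function.Exact f g) : IsPowTorsion J B := by
  obtain ⟨n, hn⟩ := hA
  obtain ⟨m, hm⟩ := hC
  refine ⟨n + m, fun r hr x => ?_⟩
  rw [pow_add] at hr
  induction hr using Submodule.mul_induction_on' with
  | mem_mul_mem a ha b hb =>
    obtain ⟨y, hy⟩ := (h (b • x)).mp (by rw [map_smul, hm b hb])
    rw [mul_smul, ← hy, ← map_smul, hn a ha, map_zero]
  | add a _ b _ ha hb => rw [add_smul, ha, hb, add_zero]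

theorem IsPowTorsion.of_surjective (h : IsPowTorsion J A) (f : A →ₗ[R] B)
    (hf : Function.Surjective f) : IsPowTorsion J B := by
  obtain ⟨n, hn⟩ := h
  refine ⟨n, fun r hr x => ?_⟩
  obtain ⟨x, rfl⟩ := hf x
  rw [← map_smul, hn r hr, map_zero]

theorem IsPowTorsion.of_finite [Module.Finite R A] (h : ∀ x : A, ∃ n, ∀ r ∈ J ^ n, r • x = 0) :
    IsPowTorsion J A := by
  obtain ⟨s, hs⟩ := Module.Finite.fg_top (R := R) (M := A)
  choose n hn using h
  refine ⟨s.sup n, fun r hr x => ?_⟩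
  have hx : x ∈ Submodule.span R (s : Set A) := hs ▸ Submodule.mem_top
  induction hx using Submodule.span_induction with
  | mem x hx => exact hn x r (Ideal.pow_le_pow_right (Finset.le_sup hx) hr)
  | zero => exact smul_zero r
  | add x y _ _ hx hy => rw [smul_add, hx, hy, add_zero]
  | smul a x _ hx => rw [smul_comm, hx, smul_zero]

/-- The module is finite over an Artinian quotient of `R`. -/
theorem IsPowTorsion.length_ne_top [IsLocalRing R] [IsNoetherianRing R] [Module.Finite R A]
    (h : IsPowTorsion (maximalIdeal R) A) : Module.length R A ≠ ⊤ := by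
  obtain ⟨n, hn⟩ := h
  -- The exponent `n + 1` keeps the ideal inside `𝔪` even when `n = 0`.
  let I := maximalIdeal R ^ (n + 1)
  have : IsArtinianRing (R ⧸ I) := by
    refine quotient_artinian_of_mem_minimalPrimes_of_isLocalRing I
      ⟨⟨inferInstance, Ideal.pow_le_self n.succ_ne_zero⟩, fun q hq _ => ?_⟩
    have := hq.1
    exact Ideal.IsPrime.le_of_pow_le hq.2
  have hI : Module.IsTorsionBySet R A I := fun x r =>
    hn r (Ideal.pow_le_pow_right n.le_succ r.2) x
  let := hI.module
  have := hI.isScalarTower (S := R)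
  have : Module.Finite (R ⧸ I) A := Module.Finite.of_restrictScalars_finite R _ _
  rw [Module.length_eq_of_surjective (R := R ⧸ I) Ideal.Quotient.mk_surjective]
  exact Module.length_ne_top

theorem exists_torsion_submodule (J : Ideal R) [IsNoetherianRing R] [Module.Finite R A] :
    ∃ T : Submodule R A, IsPowTorsion J T ∧
      ∀ n, ∀ x : A, (∀ r ∈ J ^ n, r • x = 0) → x ∈ T := by
  let T : Submodule R A :=
    { carrier := {x | ∃ n, ∀ r ∈ J ^ n, r • x = 0}
      zero_mem' := ⟨0, fun r _ => smul_zero r⟩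
      add_mem' := by
        rintro x y ⟨n, hn⟩ ⟨m, hm⟩
        refine ⟨max n m, fun r hr => ?_⟩
        rw [smul_add, hn r (Ideal.pow_le_pow_right (le_max_left n m) hr),
          hm r (Ideal.pow_le_pow_right (le_max_right n m) hr), add_zero]
      smul_mem' := by
        rintro a x ⟨n, hn⟩
        exact ⟨n, fun r hr => by rw [smul_comm, hn r hr, smul_zero]⟩ }
  refine ⟨T, IsPowTorsion.of_finite ?_, fun n x hx => ⟨n, hx⟩⟩
  rintro ⟨x, n, hn⟩
  exact ⟨n, fun r hr => Subtype.ext (hn r hr)⟩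

/-- A map `R ⧸ J ^ n → A ⧸ T` sends `1` to the class of some `x` with `J ^ n x ⊆ T`; then a higher
power of `J` kills `x`, so `x ∈ T`. Vanishing of this `Hom` yields a regular element in `J ^ n`. -/
theorem exists_isSMulRegular_quotient [IsNoetherianRing R] [Module.Finite R A]
    {T : Submodule R A} (hT : IsPowTorsion J T)
    (hT' : ∀ n, ∀ x : A, (∀ r ∈ J ^ n, r • x = 0) → x ∈ T) (n : ℕ) :
    ∃ r ∈ J ^ n, IsSMulRegular (A ⧸ T) r := by
  have : Subsingleton ((R ⧸ J ^ n) →ₗ[R] A ⧸ T) := by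
    refine subsingleton_of_forall_eq 0 fun f => ?_
    obtain ⟨x, hx⟩ := T.mkQ_surjective (f (Ideal.Quotient.mk _ 1))
    obtain ⟨m, hm⟩ := hT
    have hxT : x ∈ T := by
      refine hT' (m + n) x fun r hr => ?_
      rw [pow_add] at hr
      induction hr using Submodule.mul_induction_on' with
      | mem_mul_mem a ha b hb =>
        have hbx : b • x ∈ T := by
          rw [← T.ker_mkQ, LinearMap.mem_ker, map_smul, hx, ← map_smul]
          have : b • (Ideal.Quotient.mk (J ^ n) 1) = 0 := by
            exact (Ideal.Quotient.eq_zero_iff_mem).mpr (by simpa using hb)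
          rw [this, map_zero]
        rw [mul_smul]
        exact congrArg Subtype.val (hm a ha ⟨b • x, hbx⟩)
      | add a _ b _ ha hb => rw [add_smul, ha, hb, add_zero]
    rw [← T.ker_mkQ, LinearMap.mem_ker] at hxT
    ext
    exact hx.symm.trans hxT
  obtain ⟨r, hr, hreg⟩ := IsSMulRegular.subsingleton_linearMap_iff.mp this
  exact ⟨r, by rwa [Ideal.annihilator_quotient] at hr, hreg⟩

end Torsion

/-! ### Finite length, depth vanishing and length estimates -/

section Finiteness

open scoped Pointwise

variable {R : Type u} [CommRing R]
variable {A B C : Type u} [AddCommGroup A] [Module R A] [AddCommGroup B] [Module R B]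
  [AddCommGroup C] [Module R C]

namespace LocalCohomology

theorem subsingleton_of_isPowTorsion [IsNoetherianRing R] {J : Ideal R} (h : IsPowTorsion J A)
    (i : ℕ) : Subsingleton (LC J (i + 1) A) :=
  subsingleton_of_pow_smul_eq_zero J h.choose_spec i

theorem finite_zero [IsNoetherianRing R] (J : Ideal R) [Module.Finite R A] :
    Module.Finite R (LC J 0 A) := by
  obtain ⟨f, hf⟩ := exists_injective_zero J (A := A)
  exact Module.Finite.of_injective f hf

theorem exact_smul {r : R} (hr : IsSMulRegular A r) :
    Function.Injective (r • LinearMap.id : A →ₗ[R] A) ∧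
      Function.Exact (r • LinearMap.id : A →ₗ[R] A)
        (r • (⊤ : Submodule R A)).mkQ := by
  refine ⟨hr, fun x => ?_⟩
  rw [← LinearMap.mem_ker, Submodule.ker_mkQ, Submodule.mem_smul_pointwise_iff_exists]
  simp

/-- Local cohomology modules of a finitely generated module killed by powers of the maximal ideal
have finite length. -/
theorem length_ne_top_of_isPowTorsion [IsLocalRing R] [IsNoetherianRing R] [Module.Finite R A]
    (k : ℕ) (h : ∀ j ≤ k, IsPowTorsion (maximalIdeal R) (LC (maximalIdeal R) j A)) :
    Module.length R (LC (maximalIdeal R) k A) ≠ ⊤ := by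
  induction k generalizing A with
  | zero =>
    have := finite_zero (maximalIdeal R) (A := A)
    exact (h 0 le_rfl).length_ne_top
  | succ k ih =>
    set 𝔪 := maximalIdeal R
    obtain ⟨T, hT, hT'⟩ := exists_torsion_submodule 𝔪 (A := A)
    have hsub := subsingleton_of_isPowTorsion hT
    have hT1 (j : ℕ) : Function.Surjective (map 𝔪 j T.mkQ) := by
      obtain ⟨δ, -, h2, -⟩ := exists_delta 𝔪 T.subtype_injective (LinearMap.exact_subtype_mkQ T)
        T.mkQ_surjective j
      exact fun x => (h2 x).mp ((hsub j).elim _ _)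
    have hT2 : Function.Injective (map 𝔪 (k + 1) T.mkQ) := by
      obtain ⟨δ, h1, -, -⟩ := exists_delta 𝔪 T.subtype_injective (LinearMap.exact_subtype_mkQ T)
        T.mkQ_surjective (k + 1)
      rw [injective_iff_map_eq_zero]
      intro x hx
      obtain ⟨y, rfl⟩ := (h1 x).mp hx
      rw [(hsub k).elim y 0, map_zero]
    have hL (j : ℕ) (hj : j ≤ k + 1) : IsPowTorsion 𝔪 (LC 𝔪 j (A ⧸ T)) :=
      (h j hj).of_surjective _ (hT1 j)
    obtain ⟨n, hn⟩ := hL (k + 1) le_rfl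
    -- Choosing `r` in `𝔪 ^ n` makes it kill `H^{k+1}(A ⧸ T)`, so the connecting map from `H^k` of
    -- the quotient by `r` is surjective and the induction drops a degree.
    obtain ⟨r, hr, hreg⟩ := exists_isSMulRegular_quotient hT hT' n
    obtain ⟨hinj, hex⟩ := exact_smul hreg
    have hQ (j : ℕ) (hj : j ≤ k) : IsPowTorsion 𝔪 (LC 𝔪 j (QuotSMulTop r (A ⧸ T))) := by
      obtain ⟨δ, -, h2, -⟩ := exists_delta 𝔪 hinj hex (Submodule.mkQ_surjective _) j
      exact IsPowTorsion.of_exact (hL j (by lia)) (hL (j + 1) (by lia)) _ _ h2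
    obtain ⟨δ, -, -, h3⟩ := exists_delta 𝔪 hinj hex (Submodule.mkQ_surjective _) k
    have hδ : Function.Surjective δ := fun x => (h3 x).mp (by rw [map_smul_id, hn r hr])
    have h4 := ih hQ
    exact ne_top_of_le_ne_top h4 ((Module.length_le_of_injective _ hT2).trans
      (Module.length_le_of_surjective _ hδ))

/-- Local cohomology vanishes below the length of a regular sequence. -/
theorem subsingleton_of_isWeaklyRegular {J : Ideal R} (rs : List R) (hJ : ∀ r ∈ rs, r ∈ J)
    (h : RingTheory.Sequence.IsWeaklyRegular A rs) (j : ℕ) (hj : j < rs.length) :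
    Subsingleton (LC J j A) := by
  induction rs generalizing A j with
  | nil => simp at hj
  | cons r rs ih =>
    obtain ⟨hreg, hrs⟩ := (RingTheory.Sequence.isWeaklyRegular_cons_iff A r rs).mp h
    obtain ⟨hinj, hex⟩ := exact_smul hreg
    have hr : Function.Injective (map J j (r • LinearMap.id : A →ₗ[R] A)) := by
      obtain _ | j := j
      · obtain ⟨f, hf⟩ := exists_injective_zero J (A := A)
        refine (injective_iff_map_eq_zero _).mpr fun x hx => hf (hreg ?_)
        rw [map_smul_id] at hx
        simp only [map_zero, smul_zero]
        rw [← map_smul, hx, map_zero]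
      · obtain ⟨δ, -, -, h3⟩ := exists_delta J hinj hex (Submodule.mkQ_surjective _) j
        have := ih (fun s hs => hJ s (List.mem_cons_of_mem r hs)) hrs j (by simpa using hj)
        refine (injective_iff_map_eq_zero _).mpr fun x hx => ?_
        obtain ⟨y, rfl⟩ := (h3 x).mp hx
        rw [Subsingleton.elim y 0, map_zero]
    -- Multiplication by `r` is injective on `H^j`, yet each class is killed by a power of `r`; so
    -- `H^j` is zero.
    have hpow (n : ℕ) (x : LC J j A) (hx : r ^ n • x = 0) : x = 0 := by
      induction n generalizing x with
      | zero => simpa using hx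
      | succ n ihn =>
        refine (injective_iff_map_eq_zero _).mp hr x ?_
        rw [map_smul_id]
        exact ihn _ (by rwa [← mul_smul, ← pow_succ])
    refine subsingleton_of_forall_eq 0 fun x => ?_
    obtain ⟨n, hn⟩ := exists_pow_smul_eq_zero J x
    exact hpow n x (hn _ (Ideal.pow_mem_pow (hJ r List.mem_cons_self) n))

theorem length_congr (J : Ideal R) (e : A ≃ₗ[R] B) (i : ℕ) :
    Module.length R (LC J i A) = Module.length R (LC J i B) := by
  have hid {D : Type u} [AddCommGroup D] [Module R D] (x : LC J i D) :
      map J i LinearMap.id x = x := by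
    have := map_smul_id J i (1 : R) x
    rwa [one_smul, one_smul] at this
  refine (LinearEquiv.ofLinearMap (map J i e.toLinearMap) (map J i e.symm.toLinearMap) ?_ ?_).length_eq
  all_goals
    refine LinearMap.ext fun x => ?_
    rw [LinearMap.comp_apply, ← map_comp]
    simpa using hid x

theorem _root_.Module.length_le_add_of_exact {A B C : Type*} [AddCommGroup A] [Module R A]
    [AddCommGroup B] [Module R B] [AddCommGroup C] [Module R C] {f : A →ₗ[R] B} {g : B →ₗ[R] C}
    (h : Function.Exact f g) :
    Module.length R B ≤ Module.length R A + Module.length R C := by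
  rw [Module.length_eq_add_of_exact (LinearMap.range f).subtype (LinearMap.range f).mkQ
    (Submodule.subtype_injective _) (Submodule.mkQ_surjective _)
    (LinearMap.exact_subtype_mkQ _)]
  refine add_le_add (Module.length_le_of_surjective _ f.surjective_rangeRestrict) ?_
  refine Module.length_le_of_injective ((LinearMap.range f).liftQ g ?_) ?_
  · rw [LinearMap.exact_iff.mp h]
  · rw [← LinearMap.ker_eq_bot]
    exact Submodule.ker_liftQ_eq_bot _ _ _ (LinearMap.exact_iff.mp h).le

variable (A) in
theorem subsingleton_of_subsingleton [IsNoetherianRing R] (J : Ideal R) [Subsingleton A] (i : ℕ) :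
    Subsingleton (LC J i A) := by
  obtain _ | i := i
  · obtain ⟨f, hf⟩ := exists_injective_zero J (A := A)
    exact hf.subsingleton
  · exact subsingleton_of_isPowTorsion IsPowTorsion.of_subsingleton i

variable (A) in
theorem length_pi_le [IsNoetherianRing R] (J : Ideal R) (i n : ℕ) :
    Module.length R (LC J i (Fin n → A)) ≤ n * Module.length R (LC J i A) := by
  induction n with
  | zero =>
    have := subsingleton_of_subsingleton (Fin 0 → A) J i
    simp
  | succ n ih =>
    let f : A →ₗ[R] (Fin (n + 1) → A) := LinearMap.single R (fun _ => A) 0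
    let g : (Fin (n + 1) → A) →ₗ[R] (Fin n → A) := LinearMap.funLeft R A Fin.succ
    have hf : Function.Injective f := Pi.single_injective (M := fun _ => A) 0
    have hg : Function.Surjective g := fun x => ⟨Fin.cons 0 x, by ext; simp [g]⟩
    have hfg : Function.Exact f g := fun x => by
      constructor
      · intro hx
        refine ⟨x 0, ?_⟩
        ext j
        refine Fin.cases ?_ (fun j => ?_) j
        · simp [f]
        · simpa [f, g, LinearMap.funLeft_apply] using congr($hx j).symm
      · rintro ⟨y, rfl⟩
        ext j
        simp [f, g]
    obtain ⟨-, h1, -⟩ := exists_delta J hf hfg hg i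
    rw [Nat.cast_succ, add_mul, one_mul, add_comm (n * _ : ℕ∞)]
    exact (Module.length_le_add_of_exact h1).trans (add_le_add le_rfl ih)

end LocalCohomology

end Finiteness

/-! ### Local freeness and factorization through free modules -/

section Factorization

variable {R : Type u} [CommRing R]
variable {N : Type u} [AddCommGroup N] [Module R N]

/-- The ideal of those `r` such that multiplication by `r` on `N` factors through `π : F → N`. -/
def factorIdeal {F : Type*} [AddCommGroup F] [Module R F] (π : F →ₗ[R] N) : Ideal R where
  carrier := {r | ∃ s : N →ₗ[R] F, π ∘ₗ s = r • LinearMap.id}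
  zero_mem' := ⟨0, by simp⟩
  add_mem' := by
    rintro a b ⟨s, hs⟩ ⟨t, ht⟩
    exact ⟨s + t, by rw [LinearMap.comp_add, hs, ht, add_smul]⟩
  smul_mem' := by
    rintro c a ⟨s, hs⟩
    exact ⟨c • s, by rw [LinearMap.comp_smul, hs, smul_smul, smul_eq_mul]⟩

/-- Projectivity splits `π` over the localization. By finite presentation the splitting descends up
to a denominator `s ∉ p`, and a further `t ∉ p` makes the identity hold on `N`; thus `t * s` is in
the ideal. -/
theorem factorIdeal_not_le [IsNoetherianRing R] [Module.Finite R N] {F : Type u} [AddCommGroup F]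
    [Module R F] {π : F →ₗ[R] N} (hπ : Function.Surjective π) (p : Ideal R) [p.IsPrime]
    [Module.Projective (Localization.AtPrime p) (LocalizedModule.AtPrime p N)] :
    ¬ factorIdeal π ≤ p := by
  let S := p.primeCompl
  have : Module.FinitePresentation R N := Module.finitePresentation_of_finite R N
  let π' := LocalizedModule.map S π
  have hπ' : Function.Surjective π' := LocalizedModule.map_surjective S π hπ
  obtain ⟨σ, hσ⟩ := Module.projective_lifting_property π' LinearMap.id hπ'
  obtain ⟨h, s, hs⟩ := Module.FinitePresentation.exists_lift_of_isLocalizedModule S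
    (LocalizedModule.mkLinearMap S F)
    ((σ.restrictScalars R) ∘ₗ (LocalizedModule.mkLinearMap S N))
  have h1 : LocalizedModule.mkLinearMap S N ∘ₗ (π ∘ₗ h) =
      LocalizedModule.mkLinearMap S N ∘ₗ (s.1 • LinearMap.id) := by
    ext x
    have h2 : LocalizedModule.mkLinearMap S F (h x) =
        s.1 • σ (LocalizedModule.mkLinearMap S N x) := congr($hs x)
    have h3 : π' (σ (LocalizedModule.mkLinearMap S N x)) = LocalizedModule.mkLinearMap S N x :=
      congr($hσ _)
    have h4 (y : F) : π' (LocalizedModule.mkLinearMap S F y) =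
        LocalizedModule.mkLinearMap S N (π y) := LocalizedModule.map_mk S π y 1
    have h5 : π' (s.1 • σ (LocalizedModule.mkLinearMap S N x)) =
        s.1 • π' (σ (LocalizedModule.mkLinearMap S N x)) :=
      (π'.restrictScalars R).map_smul _ _
    simp only [LinearMap.comp_apply, LinearMap.smul_apply, LinearMap.id_apply, map_smul]
    rw [← h4, h2, h5, h3]
  obtain ⟨t, ht⟩ := Module.Finite.exists_smul_of_comp_eq_of_isLocalizedModule S
    (LocalizedModule.mkLinearMap S N) _ _ h1
  intro hle
  have : (t * s : S).1 ∈ factorIdeal π := by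
    refine ⟨t.1 • h, ?_⟩
    rw [LinearMap.comp_smul, Submonoid.coe_mul, mul_smul]
    exact ht
  exact (t * s).2 (hle this)

/-- If `N` is locally free on the punctured spectrum, a power of the maximal ideal acts on `N`
through a free module. -/
theorem exists_pow_le_factorIdeal [IsLocalRing R] [IsNoetherianRing R] [Module.Finite R N]
    (hN : IsLocallyFreeOnPuncturedSpectrum R N) {F : Type u} [AddCommGroup F]
    [Module R F] {π : F →ₗ[R] N} (hπ : Function.Surjective π) :
    ∃ n, maximalIdeal R ^ n ≤ factorIdeal π := by
  -- No prime other than `𝔪` contains the factor ideal, so `𝔪` lies in its radical.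
  refine Ideal.exists_pow_le_of_le_radical_of_fg ?_ (IsNoetherian.noetherian _)
  rw [Ideal.radical_eq_sInf]
  refine le_sInf fun p ⟨hp, hprime⟩ => ?_
  by_cases h : (⟨p, hprime⟩ : PrimeSpectrum R) = closedPoint R
  · exact (congrArg PrimeSpectrum.asIdeal h).ge
  · have := hN ⟨p, hprime⟩ h
    have : Module.Projective (Localization.AtPrime p) (LocalizedModule.AtPrime p N) :=
      Module.Projective.of_free
    exact absurd hp (factorIdeal_not_le hπ p)

/-- Multiplication by `r ∈ J ^ n` on `H^j(N)` factors through `H^j(F) = 0`. -/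
theorem LocalCohomology.isPowTorsion_of_factorIdeal {J : Ideal R} {F : Type u} [AddCommGroup F]
    [Module R F] {π : F →ₗ[R] N} {n : ℕ} (h : J ^ n ≤ factorIdeal π) {j : ℕ}
    (hF : Subsingleton (LC J j F)) : IsPowTorsion J (LC J j N) := by
  refine ⟨n, fun r hr x => ?_⟩
  obtain ⟨s, hs⟩ := h hr
  rw [← map_smul_id, ← hs, map_comp, Subsingleton.elim (map J j s x) 0, map_zero]

theorem LocalCohomology.subsingleton_pi [IsNoetherianRing R] {J : Ideal R} {j : ℕ}
    (h : Subsingleton (LC J j N)) (n : ℕ) : Subsingleton (LC J j (Fin n → N)) := by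
  rw [← Module.length_eq_zero_iff (R := R)] at h ⊢
  simpa [h] using length_pi_le N J j n

theorem LocalCohomology.subsingleton_of_lt_depth [IsLocalRing R] {j : ℕ}
    (hj : (j : ℕ∞) < localRingDepth R) : Subsingleton (LC (maximalIdeal R) j R) := by
  obtain ⟨rs, hrs⟩ := lt_iSup_iff.mp hj
  obtain ⟨⟨hreg, hmem⟩, hlt⟩ := lt_iSup_iff.mp hrs
  exact subsingleton_of_isWeaklyRegular rs hmem hreg.toIsWeaklyRegular j (by exact_mod_cast hlt)

/-- Local cohomology of a module which is locally free on the punctured spectrum has finite length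
below the depth of the ring. -/
theorem LocalCohomology.length_ne_top_of_lt_depth [IsLocalRing R] [IsNoetherianRing R]
    [Module.Finite R N] (hN : IsLocallyFreeOnPuncturedSpectrum R N) {j : ℕ}
    (hj : (j : ℕ∞) < localRingDepth R) : Module.length R (LC (maximalIdeal R) j N) ≠ ⊤ := by
  obtain ⟨k, π, hπ⟩ := Module.Finite.exists_fin' R N
  obtain ⟨n, hn⟩ := exists_pow_le_factorIdeal hN hπ
  refine length_ne_top_of_isPowTorsion j fun i hi => isPowTorsion_of_factorIdeal hn ?_
  exact subsingleton_pi (subsingleton_of_lt_depth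
    (lt_of_le_of_lt (by exact_mod_cast hi) hj)) k

end Factorization

/-! ### Grade, dimension and depth -/

section Grade

variable {R : Type u} [CommRing R] [IsNoetherianRing R] [IsLocalRing R]
variable {M : Type u} [AddCommGroup M] [Module R M] [Module.Finite R M]

/-- Vanishing of `Ext^j(M, R)` for `j < p` gives an `R`-regular sequence of length `p` inside the
annihilator of `M`, and dividing by it lowers the dimension of `R` by exactly `p`. -/
theorem supportDim_add_le_ringKrullDim [Nontrivial M] {p : ℕ} (hM : p ≤ moduleGrade R M) :
    Module.supportDim R M + p ≤ ringKrullDim R := by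
  have hext (j : ℕ) (hj : j < p) :
      Subsingleton (Abelian.Ext (ModuleCat.of R M) (ModuleCat.of R R) j) := by
    by_contra h
    rw [not_subsingleton_iff_nontrivial] at h
    have h1 : moduleGrade R M ≤ j := iInf₂_le j h
    exact absurd (hM.trans h1) (by simpa using hj)
  have hne : Module.annihilator R M ≠ ⊤ := fun h =>
    not_subsingleton M (Module.annihilator_eq_top_iff.mp h)
  obtain ⟨rs, hlen, hmem, hreg⟩ := ModuleCat.exists_isRegular_of_exists_subsingleton_ext
    (Module.annihilator R M) p (ModuleCat.of R R)
    (by simpa [lt_top_iff_ne_top] using hne) (ModuleCat.of R M)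
    Module.support_eq_zeroLocus hext
  rw [← ringKrullDim_add_length_eq_ringKrullDim_of_isRegular rs hreg, hlen,
    Module.supportDim_eq_ringKrullDim_quotient_annihilator]
  refine add_le_add ?_ le_rfl
  have hle : Ideal.ofList rs ≤ Module.annihilator R M := Ideal.span_le.mpr hmem
  exact ringKrullDim_le_of_surjective (Ideal.Quotient.factor hle)
    (Ideal.Quotient.factor_surjective hle)

theorem add_lt_localRingDepth (hR : IsCohenMacaulayLocalRing R) {p i : ℕ}
    (hM : p ≤ moduleGrade R M) (hi : (i : WithBot ℕ∞) < Module.supportDim R M) :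
    ((p + i : ℕ) : ℕ∞) < localRingDepth R := by
  have : Nontrivial M := by
    rw [← Module.supportDim_ne_bot_iff_nontrivial R]
    exact ne_bot_of_gt hi
  have h := supportDim_add_le_ringKrullDim hM
  rw [← hR.depth_eq_dim] at h
  generalize Module.supportDim R M = s at hi h
  induction s with
  | bot => simp at hi
  | coe s =>
    have h1 : (i : ℕ∞) < s := by exact_mod_cast hi
    have h2 : s + p ≤ localRingDepth R := by exact_mod_cast h
    refine lt_of_lt_of_le ?_ h2
    rw [Nat.cast_add, add_comm (p : ℕ∞)]
    exact (ENat.add_lt_add_iff_right (ENat.natCast_ne_top p)).mpr h1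

end Grade

/-! ### Minimal resolutions stop at the projective dimension -/

section MinimalResolution

variable {R : Type u} [CommRing R] [IsNoetherianRing R] [IsLocalRing R]
variable {M : Type u} [AddCommGroup M] [Module R M]

/-- A minimal cover of a projective module is an isomorphism. -/
theorem LinearMap.ker_eq_bot_of_projective {F P : Type*} [AddCommGroup F] [Module R F]
    [Module.Finite R F] [AddCommGroup P] [Module R P] [Module.Projective R P] (f : F →ₗ[R] P)
    (hf : Function.Surjective f) (h : LinearMap.ker f ≤ maximalIdeal R • (⊤ : Submodule R F)) :
    LinearMap.ker f = ⊥ := by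
  obtain ⟨s, hs⟩ := Module.projective_lifting_property f LinearMap.id hf
  -- This projection onto `ker f` sends `𝔪 F` into `𝔪 ker f`, so `ker f ≤ 𝔪 ker f` and Nakayama
  -- applies.
  let e : F →ₗ[R] F := LinearMap.id - s ∘ₗ f
  have he : LinearMap.range e ≤ LinearMap.ker f := by
    rintro _ ⟨x, rfl⟩
    have : f (s (f x)) = f x := congr($hs (f x))
    simp [e, this]
  refine Submodule.eq_bot_of_le_smul_of_le_jacobson_bot (maximalIdeal R) _
    (IsNoetherian.noetherian _) (fun x hx => ?_) (maximalIdeal_le_jacobson _)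
  have hx' : e x ∈ (maximalIdeal R • (⊤ : Submodule R F)).map e :=
    Submodule.mem_map_of_mem (h hx)
  rw [Submodule.map_smul'', Submodule.map_top] at hx'
  have hex : e x = x := by simp [e, LinearMap.mem_ker.mp hx]
  rw [← hex]
  exact Submodule.smul_mono le_rfl he hx'

omit [IsNoetherianRing R] [IsLocalRing R] in
theorem hasProjectiveDimensionLT_ker {n : ℕ} {F P : Type u} [AddCommGroup F] [Module R F]
    [Module.Projective R F] [AddCommGroup P] [Module R P] (f : F →ₗ[R] P)
    (hf : Function.Surjective f) (h : HasProjectiveDimensionLT (ModuleCat.of R P) (n + 2)) :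
    HasProjectiveDimensionLT (ModuleCat.of R (LinearMap.ker f)) (n + 1) :=
  ((f.shortExact_shortComplexKer hf).hasProjectiveDimensionLT_X₃_iff n
    (inferInstanceAs (Projective (ModuleCat.of R F)))).mp h

namespace MinimalFreeResolution

variable (F : MinimalFreeResolution R M)

omit [IsNoetherianRing R] in
theorem hasProjectiveDimensionLT_range (j n : ℕ)
    (h : HasProjectiveDimensionLT (ModuleCat.of R M) (j + n + 2)) :
    HasProjectiveDimensionLT (ModuleCat.of R (LinearMap.range (F.d j))) (n + 1) := by
  induction j generalizing n with
  | zero =>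
    rw [← LinearMap.exact_iff.mp F.exact_aug]
    exact hasProjectiveDimensionLT_ker F.aug F.aug_surjective (by simpa using h)
  | succ j ih =>
    rw [← LinearMap.exact_iff.mp (F.exact j), ← LinearMap.ker_rangeRestrict]
    exact hasProjectiveDimensionLT_ker _ (F.d j).surjective_rangeRestrict
      (ih (n + 1) (by convert h using 1; lia))

/-- The `p`-th syzygy (`M` itself if `p = 0`) is projective, so its minimal cover is injective; the
kernel of that cover is the range of `F.d p`. -/
theorem d_eq_zero (p : ℕ) (h : HasProjectiveDimensionLE (ModuleCat.of R M) p) : F.d p = 0 := by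
  rw [← LinearMap.range_eq_bot]
  obtain _ | p := p
  · have h' : HasProjectiveDimensionLT (ModuleCat.of R M) 1 := h
    have : Module.Projective R M := (IsProjective.iff_projective M).mpr inferInstance
    have h1 := F.aug.ker_eq_bot_of_projective F.aug_surjective
      ((LinearMap.exact_iff.mp F.exact_aug).trans_le (F.minimal 0))
    rwa [LinearMap.exact_iff.mp F.exact_aug] at h1
  · have h1 : HasProjectiveDimensionLT (ModuleCat.of R (LinearMap.range (F.d p))) 1 :=
      F.hasProjectiveDimensionLT_range p 0 h
    have : Module.Projective R (LinearMap.range (F.d p)) :=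
      (IsProjective.iff_projective _).mpr inferInstance
    have h2 := (F.d p).rangeRestrict.ker_eq_bot_of_projective (F.d p).surjective_rangeRestrict
      (by
        rw [LinearMap.ker_rangeRestrict, LinearMap.exact_iff.mp (F.exact p)]
        exact F.minimal (p + 1))
    rwa [LinearMap.ker_rangeRestrict, LinearMap.exact_iff.mp (F.exact p)] at h2

end MinimalFreeResolution

end MinimalResolution

/-! ### The length inequality along the tensored resolution -/

section Inequality

variable {R : Type u} [CommRing R]
variable {N : Type u} [AddCommGroup N] [Module R N]

/-- Multiplication by an element of the factor ideal of a flat module kills the homology of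
tensor products with `N`. -/
theorem smul_mem_range_rTensor {A B C F : Type u} [AddCommGroup A] [Module R A] [AddCommGroup B]
    [Module R B] [AddCommGroup C] [Module R C] [AddCommGroup F] [Module R F] [Module.Flat R F]
    {π : F →ₗ[R] N} {f : A →ₗ[R] B} {g : B →ₗ[R] C} (hfg : Function.Exact f g) {r : R}
    (hr : r ∈ factorIdeal π) {z : B ⊗[R] N} (hz : g.rTensor N z = 0) :
    r • z ∈ LinearMap.range (f.rTensor N) := by
  obtain ⟨s, hs⟩ := hr
  have h1 : r • z = π.lTensor B (s.lTensor B z) := by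
    rw [← LinearMap.comp_apply, ← LinearMap.lTensor_comp, hs, LinearMap.lTensor_smul]
    simp
  have h2 : g.rTensor F (s.lTensor B z) = 0 := by
    rw [← LinearMap.comp_apply, LinearMap.rTensor_comp_lTensor, ← LinearMap.lTensor_comp_rTensor,
      LinearMap.comp_apply, hz, map_zero]
  obtain ⟨v, hv⟩ := (Module.Flat.rTensor_exact F hfg _).mp h2
  rw [h1, ← hv, ← LinearMap.comp_apply, LinearMap.lTensor_comp_rTensor,
    ← LinearMap.rTensor_comp_lTensor]
  exact ⟨_, rfl⟩

variable [IsLocalRing R] [IsNoetherianRing R] [Module.Finite R N]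
variable {M : Type u} [AddCommGroup M] [Module R M]

namespace LocalCohomology

omit [IsLocalRing R] [Module.Finite R N] in
theorem length_tensor_pi_le (J : Ideal R) (i n : ℕ) :
    Module.length R (LC J i ((Fin n → R) ⊗[R] N)) ≤ n * Module.length R (LC J i N) :=
  (length_congr J (TensorProduct.comm R (Fin n → R) N ≪≫ₗ
    TensorProduct.piScalarRight R R N (Fin n)) i).trans_le (length_pi_le N J i n)

/-- The inequality between the local cohomology of consecutive boundary modules. -/
theorem length_range_rTensor_le (hN : IsLocallyFreeOnPuncturedSpectrum R N)
    {A B C : Type u} [AddCommGroup A] [Module R A] [AddCommGroup B]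
    [Module R B] [Module.Finite R B] [AddCommGroup C] [Module R C]
    {f : A →ₗ[R] B} {g : B →ₗ[R] C} (hfg : Function.Exact f g) (i : ℕ) :
    Module.length R (LC (maximalIdeal R) i (LinearMap.range (g.rTensor N))) ≤
      Module.length R (LC (maximalIdeal R) i (B ⊗[R] N)) +
        Module.length R (LC (maximalIdeal R) (i + 1) (LinearMap.range (f.rTensor N))) := by
  set 𝔪 := maximalIdeal R
  let Z := LinearMap.ker (g.rTensor N)
  let Y := LinearMap.range (f.rTensor N)
  have hYZ : Y ≤ Z := by
    rintro _ ⟨x, rfl⟩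
    change g.rTensor N (f.rTensor N x) = 0
    rw [← LinearMap.comp_apply, ← LinearMap.rTensor_comp, hfg.linearMap_comp_eq_zero]
    simp
  obtain ⟨δ, -, h1, -⟩ := exists_delta 𝔪 Z.subtype_injective
    (f := Z.subtype) (g := (g.rTensor N).rangeRestrict)
    (by rw [LinearMap.exact_iff, LinearMap.ker_rangeRestrict, Submodule.range_subtype])
    (LinearMap.surjective_rangeRestrict _) i
  refine (Module.length_le_add_of_exact h1).trans (add_le_add le_rfl ?_)
  let ι := Submodule.inclusion hYZ
  obtain ⟨-, h2, -⟩ := exists_delta 𝔪 (Submodule.inclusion_injective hYZ)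
    (LinearMap.exact_map_mkQ_range ι) (Submodule.mkQ_surjective _) (i + 1)
  -- This quotient is the homology of the tensored sequence at `B ⊗ N`; as its `H^{i+1}` vanishes,
  -- `H^{i+1}(Y)` surjects onto `H^{i+1}(Z)`.
  have htor : IsPowTorsion 𝔪 (Z ⧸ LinearMap.range ι) := by
    obtain ⟨k, π, hπ⟩ := Module.Finite.exists_fin' R N
    obtain ⟨n, hn⟩ := exists_pow_le_factorIdeal hN hπ
    refine ⟨n, fun r hr x => ?_⟩
    obtain ⟨z, rfl⟩ := Submodule.mkQ_surjective _ x
    rw [← map_smul, ← LinearMap.mem_ker, Submodule.ker_mkQ]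
    exact ⟨⟨r • z.1, smul_mem_range_rTensor hfg (hn hr) z.2⟩, rfl⟩
  have := subsingleton_of_isPowTorsion htor i
  refine (Module.length_le_add_of_exact h2).trans ?_
  rw [Module.length_eq_zero (M := LC 𝔪 (i + 1) (Z ⧸ LinearMap.range ι)), add_zero]

/-- Each step trades the boundary remainder for one more free term and the next boundary module, one
cohomological degree higher. -/
theorem length_tensor_le_sum_add (F : MinimalFreeResolution R M)
    (hN : IsLocallyFreeOnPuncturedSpectrum R N) (i q : ℕ) :
    Module.length R (LC (maximalIdeal R) i (M ⊗[R] N)) ≤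
      ∑ j ∈ Finset.range (q + 1),
        (F.rank j : ℕ∞) * Module.length R (LC (maximalIdeal R) (j + i) N) +
      Module.length R (LC (maximalIdeal R) (q + i + 1) (LinearMap.range ((F.d q).rTensor N))) := by
  induction q with
  | zero =>
    have hex : Function.Exact ((F.d 0).rTensor N) (F.aug.rTensor N) :=
      rTensor_exact N F.exact_aug F.aug_surjective
    let Y := LinearMap.range ((F.d 0).rTensor N)
    have hex' : Function.Exact Y.subtype (F.aug.rTensor N) := by
      rw [LinearMap.exact_iff, Submodule.range_subtype, LinearMap.exact_iff.mp hex]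
    obtain ⟨δ, -, h1, -⟩ := exists_delta (A := Y) (f := Y.subtype)
      (g := F.aug.rTensor N) (maximalIdeal R) Y.subtype_injective hex'
      (LinearMap.rTensor_surjective N F.aug_surjective) i
    refine (Module.length_le_add_of_exact h1).trans (add_le_add ?_ ?_)
    · rw [zero_add, Finset.sum_range_one, zero_add i]
      exact length_tensor_pi_le (N := N) (maximalIdeal R) i (F.rank 0)
    · rw [zero_add]
  | succ q ih =>
    refine ih.trans ?_
    rw [Finset.sum_range_succ _ (q + 1)]
    refine le_trans (add_le_add le_rfl ?_) (add_assoc _ _ _).ge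
    have h := length_range_rTensor_le hN (F.exact q) (q + i + 1)
    have hq : q + i + 1 = q + 1 + i := by lia
    rw [hq] at h ⊢
    exact h.trans (add_le_add (length_tensor_pi_le _ _ _) le_rfl)

theorem length_tensor_le_sum (F : MinimalFreeResolution R M)
    (hN : IsLocallyFreeOnPuncturedSpectrum R N) (i p : ℕ)
    (hp : HasProjectiveDimensionLE (ModuleCat.of R M) p) :
    Module.length R (LC (maximalIdeal R) i (M ⊗[R] N)) ≤
      ∑ j ∈ Finset.range (p + 1),
        (F.rank j : ℕ∞) * Module.length R (LC (maximalIdeal R) (j + i) N) := by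
  refine (length_tensor_le_sum_add F hN i p).trans ?_
  have : Subsingleton (LinearMap.range ((F.d p).rTensor N)) := by
    rw [F.d_eq_zero p hp, LinearMap.rTensor_zero, LinearMap.range_zero]
    infer_instance
  have := subsingleton_of_subsingleton (LinearMap.range ((F.d p).rTensor N)) (maximalIdeal R)
    (p + i + 1)
  rw [Module.length_eq_zero
    (M := LC (maximalIdeal R) (p + i + 1) (LinearMap.range ((F.d p).rTensor N))), add_zero]

omit [IsNoetherianRing R] in
theorem length_eq (L : Type u) [AddCommGroup L] [Module R L] (i : ℕ) :
    Module.length R (LC (maximalIdeal R) i L) = localCohomologyLength R L i :=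
  (equiv (maximalIdeal R) L i).length_eq

end LocalCohomology

end Inequality

theorem mainTheorem11 (R : Type u) [CommRing R] [IsLocalRing R] [IsNoetherianRing R]
    (hR : IsCohenMacaulayLocalRing R)
    (M : Type u) [AddCommGroup M] [Module R M] [Module.Finite R M] (hM : IsPerfectModule R M)
    (N : Type u) [AddCommGroup N] [Module R N] [Module.Finite R N]
    (hN : IsLocallyFreeOnPuncturedSpectrum R N)
    (hNr : HasConstantRankOnPuncturedSpectrum R N)
    (p : ℕ) (hp : projectiveDimension (ModuleCat.of R M) = p)
    (i : ℕ) (hi : (i : WithBot ℕ∞) < Module.supportDim R M) :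
    localCohomologyLength R (M ⊗[R] N) i ≠ ⊤ ∧
    (∀ j ≤ p, localCohomologyLength R N (j + i) ≠ ⊤) ∧
    localCohomologyLength R (M ⊗[R] N) i ≤
      ∑ j ∈ Finset.range (p + 1), (bettiNumber R M j : ℕ∞) * localCohomologyLength R N (j + i) := by
  have hle : HasProjectiveDimensionLE (ModuleCat.of R M) p :=
    (projectiveDimension_le_iff _ p).mp hp.le
  have hgrade : (p : ℕ∞) ≤ moduleGrade R M := by
    obtain ⟨q, hq, hq'⟩ := hM
    have hqp : q = p := by exact_mod_cast hq.symm.trans hp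
    exact (hqp ▸ hq').ge
  -- The top degree `p + i` is below the depth, hence so is every `j + i` in the sum.
  have hlt := add_lt_localRingDepth hR hgrade hi
  have hfin (j : ℕ) (hj : j ≤ p) : localCohomologyLength R N (j + i) ≠ ⊤ := by
    rw [← LocalCohomology.length_eq]
    exact LocalCohomology.length_ne_top_of_lt_depth hN
      (lt_of_le_of_lt (by exact_mod_cast Nat.add_le_add_right hj i) hlt)
  have hsum := LocalCohomology.length_tensor_le_sum
    (Classical.choice (nonempty_minimalFreeResolution R M)) hN i p hle
  simp only [LocalCohomology.length_eq] at hsum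
  refine ⟨ne_top_of_le_ne_top ?_ hsum, hfin, hsum⟩
  refine (ENat.sum_ne_top).mpr fun j hj => ?_
  exact WithTop.mul_ne_top (ENat.natCast_ne_top _) (hfin j (Nat.lt_succ_iff.mp (Finset.mem_range.mp hj)))
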